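/- Let $\mathcal D'(\mathbb R)$ be the space of distributions on $\mathbb R$, with real or with complex values throughout. Let $\mathcal B_c(\mathbb T)$ be the set of continuous functions $F$ on $\mathbb R$ with $F(-\pi)=0$ and $F(y+2n\pi)=F(y)+nF(\pi)$ for all $y\in[-\pi,\pi)$ and $n\in\mathbb Z$, and let $\mathcal A_c(\mathbb T)=\{f\in\mathcal D'(\mathbb R) : f=F' \text{ for some } F\in\mathcal B_c(\mathbb T)\}$, where $F'$ is the distributional derivative. For $f=F'\in\mathcal A_c(\mathbb T)$ with $F\in\mathcal B_c(\mathbb T)$ put $\int_a^b f=F(b)-F(a)$ and let $\|f\|_{\mathbb T}=\sup_{|b-a|\le 2\pi}\left|\int_a^b f\right|$ be the Alexiewicz norm. Let $L^1(\mathbb T)$ be the space of $2\pi$-periodic functions that are Lebesgue integrable on $[-\pi,\pi)$; such a function is identified with the distribution it defines. For $\varphi,g\in L^1(\mathbb T)$ let $\varphi*g(x)=\int_{-\pi}^{\pi}\varphi(x-t)g(t)\,dt$. For $g\in L^1(\mathbb T)$ and $h\in\mathcal A_c(\mathbb T)$ the convolution $g*h$ is the element $u$ of $\mathcal A_c(\mathbb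 T)$ such that $\|\varphi_k*g-u\|_{\mathbb T}\to 0$ for every sequence $(\varphi_k)$ in $L^1(\mathbb T)$ with $\|\varphi_k-h\|_{\mathbb T}\to 0$. **Theorem 5.** For all $g\in L^1(\mathbb T)$ and $h\in\mathcal A_c(\mathbb T)$ the convolution $g*h\in\mathcal A_c(\mathbb T)$ exists and is unique, and $$\mathcal A_c(\mathbb T)=L^1(\mathbb T)*\mathcal A_c(\mathbb T),$$ that is, the elements of $\mathcal A_c(\mathbb T)$ are exactly the distributions $g*h$ with $g\in L^1(\mathbb T)$ and $h\in\mathcal A_c(\mathbb T)$. -/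

import Mathlib

open scoped Distributions LineDeriv

namespace ContinuousPrimitive

open Real Set Filter Topology MeasureTheory TopologicalSpace

variable {𝕜 : Type*} [RCLike 𝕜]

/-- The distribution `T_f` on the real line defined by a locally integrable function `f`,
`⟨T_f, φ⟩ = ∫ φ(x) f(x) dx`. -/
noncomputable def toDistribution (f : ℝ → 𝕜) : 𝓓'((⊤ : Opens ℝ), 𝕜) :=
  TestFunction.integralAgainstBilinCLM (ContinuousLinearMap.lsmul ℝ ℝ) volume f

theorem toDistribution_apply {f : ℝ → 𝕜} (hf : LocallyIntegrable f volume)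
    (φ : 𝓓((⊤ : Opens ℝ), ℝ)) : toDistribution f φ = ∫ x, φ x • f x := by
  have h : LocallyIntegrableOn f ((⊤ : Opens ℝ) : Set ℝ) volume := hf.locallyIntegrableOn _
  exact TestFunction.integralAgainstBilinCLM_eq_integral h

/-- The distributional derivative `T'`, `⟨T', φ⟩ = -⟨T, φ'⟩`. -/
noncomputable def derivative (T : 𝓓'((⊤ : Opens ℝ), 𝕜)) : 𝓓'((⊤ : Opens ℝ), 𝕜) :=
  ∂_{(1 : ℝ)} T

theorem derivative_apply (T : 𝓓'((⊤ : Opens ℝ), 𝕜)) (φ : 𝓓((⊤ : Opens ℝ), ℝ)) :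
    derivative T φ = -T (∂_{(1 : ℝ)} φ) := by
  rw [derivative, Distribution.lineDerivOp_apply_apply, map_neg]

theorem testFunction_deriv_apply (φ : 𝓓((⊤ : Opens ℝ), ℝ)) (x : ℝ) :
    (∂_{(1 : ℝ)} φ) x = deriv φ x := by
  rw [TestFunction.lineDerivOp_eq_lineDerivCLM (𝕜 := ℝ),
    TestFunction.lineDerivCLM_apply_of_le (𝕜 := ℝ) (by simp)]
  have hd : DifferentiableAt ℝ φ x := φ.contDiff.differentiable (by simp) x
  rw [hd.lineDeriv_eq_fderiv, fderiv_eq_smul_deriv, one_smul]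

variable (𝕜) in
/-- The space `B_c(𝕋)` of primitives: continuous functions on the line that vanish at `-π` and
satisfy `F(y + 2nπ) = F(y) + n F(π)` for `y ∈ [-π, π)` and all integers `n`. -/
def Bc : Set (ℝ → 𝕜) :=
  {F | Continuous F ∧ F (-π) = 0 ∧
    ∀ y ∈ Ico (-π) π, ∀ n : ℤ, F (y + 2 * n * π) = F y + n * F π}

/-- `F` is a primitive in `B_c(𝕋)` of the distribution `f`. -/
def IsPrimitive (F : ℝ → 𝕜) (f : 𝓓'((⊤ : Opens ℝ), 𝕜)) : Prop :=
  F ∈ Bc 𝕜 ∧ derivative (toDistribution F) = f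

variable (𝕜) in
/-- The space `A_c(𝕋)` of distributions with a continuous primitive integral on the torus. -/
def Ac : Set 𝓓'((⊤ : Opens ℝ), 𝕜) :=
  {f | ∃ F, IsPrimitive F f}

open Classical in
/-- The primitive in `B_c(𝕋)` of a distribution in `A_c(𝕋)` (and `0` for other distributions). -/
noncomputable def primitive (f : 𝓓'((⊤ : Opens ℝ), 𝕜)) : ℝ → 𝕜 :=
  if h : ∃ F, IsPrimitive F f then h.choose else 0

theorem primitive_spec {f : 𝓓'((⊤ : Opens ℝ), 𝕜)} (hf : f ∈ Ac 𝕜) :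
    IsPrimitive (primitive f) f := by
  have h : ∃ F, IsPrimitive F f := hf
  rw [primitive, dif_pos h]
  exact h.choose_spec

/-- The continuous primitive integral `∫_a^b f = F(b) - F(a)` of `f ∈ A_c(𝕋)`. -/
noncomputable def cpIntegral (f : 𝓓'((⊤ : Opens ℝ), 𝕜)) (a b : ℝ) : 𝕜 :=
  primitive f b - primitive f a

/-- The Alexiewicz norm `sup |∫_I f|`, over intervals `I` of length at most `2π`. -/
noncomputable def alexiewiczNorm (f : 𝓓'((⊤ : Opens ℝ), 𝕜)) : ℝ :=
  sSup {r : ℝ | ∃ a b : ℝ, |b - a| ≤ 2 * π ∧ r = ‖cpIntegral f a b‖}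

variable (𝕜) in
/-- The functions of `L¹(𝕋)`, as `2π`-periodic functions on the line that are Lebesgue integrable
over a period. -/
def L1 : Set (ℝ → 𝕜) :=
  {g | Function.Periodic g (2 * π) ∧ IntegrableOn g (Ico (-π) π) volume}

/-- The usual convolution of two functions of `L¹(𝕋)`. -/
noncomputable def conv (φ g : ℝ → 𝕜) : ℝ → 𝕜 :=
  fun x => ∫ t in (-π)..π, φ (x - t) * g t

/-- `u ∈ A_c(𝕋)` is the convolution of `g ∈ L¹(𝕋)` and `h ∈ A_c(𝕋)`: whenever functions
`φ k ∈ L¹(𝕋)` tend to `h` in the Alexiewicz norm, the ordinary convolutions of `φ k` and `g`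
tend to `u` in the Alexiewicz norm. -/
def IsConvolution (g : ℝ → 𝕜) (h u : 𝓓'((⊤ : Opens ℝ), 𝕜)) : Prop :=
  u ∈ Ac 𝕜 ∧ ∀ φ : ℕ → ℝ → 𝕜, (∀ k, φ k ∈ L1 𝕜) →
    Tendsto (fun k => alexiewiczNorm (toDistribution (φ k) - h)) atTop (𝓝 0) →
    Tendsto (fun k => alexiewiczNorm (toDistribution (conv (φ k) g) - u)) atTop (𝓝 0)

end ContinuousPrimitive

namespace ContinuousPrimitive

open Real Set Filter Topology MeasureTheory TopologicalSpace

variable {𝕜 : Type*} [RCLike 𝕜]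

/-! Everything is carried out on primitives. A distribution in `Ac` has exactly one primitive in
`Bc`, and if `H` is that of `h`, then `g * h` has to have the primitive `convPrimitive g H`, whose
increment over `[a, b]` is the integral of `H (b - t) - H (a - t)` against `g t`. Hence convolution
with `g` multiplies the Alexiewicz norm by at most the `L¹` norm of `g`, which gives existence
(`isConvolution_of_isPrimitive`). Uniqueness holds because `L¹` is dense (`exists_L1_tendsto`) and
the norm separates points of `Ac` (`IsConvolution.unique`).

For the factorization, a primitive is a continuous periodic function plus an affine one. Cohen's
method (`exists_factorization`), applied to `L¹` of the circle acting on continuous functions with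
the approximate units `δ⁻¹ 1_{(0, δ]}`, writes a continuous periodic function as a convolution
(`exists_circleConv_eq`). The affine part is recovered by adding an affine term to the continuous
factor, which requires that `g` have nonzero integral; a constant added before factoring forces this
(`exists_convPrimitive_eq`). -/

/-! ### Distributions with vanishing derivative. -/

theorem toDistribution_sub {F G : ℝ → 𝕜} (hF : LocallyIntegrable F) (hG : LocallyIntegrable G) :
    toDistribution (F - G) = toDistribution F - toDistribution G := by
  refine DFunLike.ext _ _ fun φ => ?_
  have key {E : ℝ → 𝕜} (hE : LocallyIntegrable E) : Integrable fun x => φ x • E x :=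
    hE.integrable_smul_left_of_hasCompactSupport φ.continuous φ.hasCompactSupport
  change _ = toDistribution F φ - toDistribution G φ
  rw [toDistribution_apply (hF.sub hG), toDistribution_apply hF, toDistribution_apply hG,
    ← integral_sub (key hF) (key hG)]
  simp [smul_sub]

theorem derivative_sub (S T : 𝓓'((⊤ : Opens ℝ), 𝕜)) :
    derivative (S - T) = derivative S - derivative T := by
  refine DFunLike.ext _ _ fun φ => ?_
  change _ = derivative S φ - derivative T φ
  simp only [derivative_apply]
  change -(S _ - T _) = _
  abel

/-- A continuous function whose distributional derivative vanishes is constant. -/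
theorem eq_of_derivative_toDistribution_eq_zero {F : ℝ → 𝕜} (hF : Continuous F)
    (h : derivative (toDistribution F) = 0) (x y : ℝ) : F x = F y := by
  have hint (ψ : ℝ → ℝ) (hψ : ContDiff ℝ (⊤ : ℕ∞) ψ) (hc : HasCompactSupport ψ) :
      ∫ t, deriv ψ t • F t = 0 := by
    have h1 := DFunLike.congr_fun h (⟨ψ, hψ, hc, by simp⟩ : 𝓓((⊤ : Opens ℝ), ℝ))
    rw [derivative_apply, toDistribution_apply hF.locallyIntegrable] at h1
    simp only [testFunction_deriv_apply] at h1
    exact neg_eq_zero.mp h1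
  let φ : ℕ → ContDiffBump (0 : ℝ) := fun n =>
    ⟨1 / (n + 1), 2 / (n + 1), by positivity, by gcongr; norm_num⟩
  have hφ : Tendsto (fun n => (φ n).rOut) atTop (𝓝 0) := by
    have := (tendsto_one_div_add_atTop_nhds_zero_nat (𝕜 := ℝ)).const_mul 2
    simpa [φ, div_eq_mul_inv] using this
  have hconst (n : ℕ) :
      (convolution ((φ n).normed volume) F (ContinuousLinearMap.lsmul ℝ ℝ) volume) x =
      (convolution ((φ n).normed volume) F (ContinuousLinearMap.lsmul ℝ ℝ) volume) y := by
    set ψ := (φ n).normed volume with hψ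
    have hψ1 : ContDiff ℝ (⊤ : ℕ∞) ψ := (φ n).contDiff_normed
    have hψ2 : HasCompactSupport ψ := (φ n).hasCompactSupport_normed
    have hd (z : ℝ) := hψ2.hasDerivAt_convolution_left (ContinuousLinearMap.lsmul ℝ ℝ)
      (μ := volume) (hψ1.of_le (by exact_mod_cast le_top)) hF.locallyIntegrable z
    refine is_const_of_deriv_eq_zero (𝕜 := ℝ) (fun z => (hd z).differentiableAt)
      (fun z => ?_) x y
    -- The derivative of the mollification at `z` is, up to sign, the pairing of `F'` with the test
    -- function `t ↦ ψ (z - t)`.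
    rw [(hd z).deriv, convolution_lsmul_swap]
    have h2 := hint (fun t => ψ (z - t)) (hψ1.comp (contDiff_const.sub contDiff_id))
      (hψ2.comp_homeomorph (Homeomorph.subLeft z))
    simp only [deriv_comp_const_sub, neg_smul, integral_neg, neg_eq_zero] at h2
    exact h2
  have hx := ContDiffBump.convolution_tendsto_right_of_continuous (μ := volume) hφ hF x
  have hy := ContDiffBump.convolution_tendsto_right_of_continuous (μ := volume) hφ hF y
  exact tendsto_nhds_unique (hx.congr hconst) hy

/-! ### The space of primitives. -/

theorem Bc.add_two_pi {F : ℝ → 𝕜} (hF : F ∈ Bc 𝕜) (x : ℝ) : F (x + 2 * π) = F x + F π := by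
  obtain ⟨n, hn, -⟩ := existsUnique_sub_zsmul_mem_Ico two_pi_pos x (-π)
  set y := x - n • (2 * π) with hy
  have hn : y ∈ Ico (-π) π := by convert! hn using 2; ring
  have h1 := hF.2.2 y hn n
  have h2 := hF.2.2 y hn (n + 1)
  have e1 : y + 2 * n * π = x := by simp [hy]; ring
  have e2 : y + 2 * (n + 1 : ℤ) * π = x + 2 * π := by simp [hy]; ring
  rw [e1] at h1
  rw [e2] at h2
  rw [h1, h2]
  push_cast
  ring

theorem mem_Bc {F : ℝ → 𝕜} {c : 𝕜} (hF : Continuous F) (h0 : F (-π) = 0)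
    (h : ∀ x, F (x + 2 * π) = F x + c) : F ∈ Bc 𝕜 := by
  have hc : F π = c := by
    have := h (-π)
    rwa [h0, zero_add, show -π + 2 * π = π by ring] at this
  refine ⟨hF, h0, fun y _ n => ?_⟩
  induction n using Int.induction_on with
  | zero => simp
  | succ n ih =>
    have := h (y + 2 * (n : ℤ) * π)
    rw [ih] at this
    rw [show y + 2 * ((n + 1 : ℤ) : ℝ) * π = y + 2 * (n : ℤ) * π + 2 * π by push_cast; ring,
      this, hc]
    push_cast
    ring
  | pred n ih =>
    have := h (y + 2 * (-n - 1 : ℤ) * π)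
    rw [show y + 2 * ((-n - 1 : ℤ) : ℝ) * π + 2 * π = y + 2 * (-n : ℤ) * π by push_cast; ring,
      ih] at this
    rw [eq_sub_of_add_eq this.symm, hc]
    push_cast
    ring

theorem Bc.sub {F G : ℝ → 𝕜} (hF : F ∈ Bc 𝕜) (hG : G ∈ Bc 𝕜) : F - G ∈ Bc 𝕜 :=
  mem_Bc (c := F π - G π) (hF.1.sub hG.1) (by simp [hF.2.1, hG.2.1]) fun x => by
    simp only [Pi.sub_apply, Bc.add_two_pi hF, Bc.add_two_pi hG]
    ring

/-- Removing the affine part leaves a function on the circle, where compactness and the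
factorization are available. -/
theorem Bc.periodic {F : ℝ → 𝕜} (hF : F ∈ Bc 𝕜) :
    Function.Periodic (fun x => F x - F π / (2 * π) * (x + π)) (2 * π) := fun x => by
  have : (π : 𝕜) ≠ 0 := RCLike.ofReal_ne_zero.mpr pi_ne_zero
  simp only [Bc.add_two_pi hF]
  push_cast
  field_simp
  ring

theorem uniformContinuous_of_periodic {G : ℝ → 𝕜} (hG : Continuous G)
    (hp : Function.Periodic G (2 * π)) : UniformContinuous G := by
  have : Fact (0 < 2 * π) := ⟨two_pi_pos⟩
  have h1 : Continuous (hp.lift : AddCircle (2 * π) → 𝕜) := continuous_coinduced_dom.mpr hG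
  have h2 : UniformContinuous ((↑) : ℝ → AddCircle (2 * π)) :=
    uniformContinuous_addMonoidHom_of_continuous (f := QuotientAddGroup.mk' _)
      (AddCircle.continuous_mk' _)
  exact (CompactSpace.uniformContinuous_of_continuous h1).comp h2

theorem Bc.uniformContinuous {F : ℝ → 𝕜} (hF : F ∈ Bc 𝕜) : UniformContinuous F := by
  have h1 : Continuous (fun x : ℝ => F x - F π / (2 * π) * (x + π)) :=
    hF.1.sub (by fun_prop)
  have h2 := uniformContinuous_of_periodic h1 (Bc.periodic hF)
  have h3 : UniformContinuous (fun x : ℝ => F π / (2 * π) * ((x : 𝕜) + π)) := by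
    have : UniformContinuous ((↑) : ℝ → 𝕜) := RCLike.ofRealCLM.uniformContinuous
    exact ((ContinuousLinearMap.mul ℝ 𝕜 (F π / (2 * π))).uniformContinuous).comp
      (this.add uniformContinuous_const)
  convert! h2.add h3 using 1
  ext x
  simp

/-! ### Uniqueness of primitives and the Alexiewicz norm. -/

theorem IsPrimitive.unique {F G : ℝ → 𝕜} {f : 𝓓'((⊤ : Opens ℝ), 𝕜)} (hF : IsPrimitive F f)
    (hG : IsPrimitive G f) : F = G := by
  ext x
  have h := eq_of_derivative_toDistribution_eq_zero (hF.1.1.sub hG.1.1) (by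
    rw [toDistribution_sub hF.1.1.locallyIntegrable hG.1.1.locallyIntegrable, derivative_sub,
      hF.2, hG.2, sub_self]) x (-π)
  simpa [hF.1.2.1, hG.1.2.1, sub_eq_zero] using h

theorem IsPrimitive.primitive_eq {F : ℝ → 𝕜} {f : 𝓓'((⊤ : Opens ℝ), 𝕜)} (hF : IsPrimitive F f) :
    primitive f = F :=
  (primitive_spec ⟨F, hF⟩).unique hF

theorem IsPrimitive.sub {F G : ℝ → 𝕜} {f g : 𝓓'((⊤ : Opens ℝ), 𝕜)} (hF : IsPrimitive F f)
    (hG : IsPrimitive G g) : IsPrimitive (F - G) (f - g) :=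
  ⟨Bc.sub hF.1 hG.1, by
    rw [toDistribution_sub hF.1.1.locallyIntegrable hG.1.1.locallyIntegrable, derivative_sub,
      hF.2, hG.2]⟩

theorem IsPrimitive.alexiewiczNorm_eq {F : ℝ → 𝕜} {f : 𝓓'((⊤ : Opens ℝ), 𝕜)}
    (hF : IsPrimitive F f) :
    alexiewiczNorm f = sSup {r : ℝ | ∃ a b : ℝ, |b - a| ≤ 2 * π ∧ r = ‖F b - F a‖} := by
  simp only [alexiewiczNorm, cpIntegral, hF.primitive_eq]

theorem IsPrimitive.alexiewiczNorm_le {F : ℝ → 𝕜} {f : 𝓓'((⊤ : Opens ℝ), 𝕜)}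
    (hF : IsPrimitive F f) {C : ℝ} (h : ∀ a b : ℝ, |b - a| ≤ 2 * π → ‖F b - F a‖ ≤ C) :
    alexiewiczNorm f ≤ C := by
  rw [hF.alexiewiczNorm_eq]
  refine csSup_le ⟨_, 0, 0, by simp [pi_pos.le], rfl⟩ ?_
  rintro _ ⟨a, b, hab, rfl⟩
  exact h a b hab

/-- The increment over a fixed length is periodic in its starting point, so a compact set of pairs
suffices. This keeps `sSup` in the norm from taking its default value. -/
theorem Bc.exists_bound {F : ℝ → 𝕜} (hF : F ∈ Bc 𝕜) :
    ∃ C, ∀ a b : ℝ, |b - a| ≤ 2 * π → ‖F b - F a‖ ≤ C := by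
  have hc : ContinuousOn (fun p : ℝ × ℝ => F p.2 - F p.1)
      (Icc (-π) π ×ˢ Icc (-(3 * π)) (3 * π)) :=
    ((hF.1.comp continuous_snd).sub (hF.1.comp continuous_fst)).continuousOn
  obtain ⟨C, hC⟩ := (isCompact_Icc.prod isCompact_Icc).exists_bound_of_continuousOn hc
  refine ⟨C, fun a b hab => ?_⟩
  have hper : Function.Periodic (fun x => F (x + (b - a)) - F x) (2 * π) := fun x => by
    simp only [add_right_comm x (2 * π), Bc.add_two_pi hF]
    ring
  obtain ⟨y, hy, he⟩ := hper.exists_mem_Ico two_pi_pos a (-π)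
  simp only [add_sub_cancel] at he
  rw [he]
  have := abs_le.mp hab
  refine hC (y, y + (b - a)) ⟨⟨hy.1, ?_⟩, ?_, ?_⟩ <;> dsimp only <;> linarith [hy.1, hy.2]

theorem IsPrimitive.norm_sub_le {F : ℝ → 𝕜} {f : 𝓓'((⊤ : Opens ℝ), 𝕜)} (hF : IsPrimitive F f)
    {a b : ℝ} (hab : |b - a| ≤ 2 * π) : ‖F b - F a‖ ≤ alexiewiczNorm f := by
  rw [hF.alexiewiczNorm_eq]
  obtain ⟨C, hC⟩ := Bc.exists_bound hF.1
  refine le_csSup ⟨C, ?_⟩ ⟨a, b, hab, rfl⟩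
  rintro _ ⟨a, b, hab, rfl⟩
  exact hC a b hab

theorem IsPrimitive.alexiewiczNorm_nonneg {F : ℝ → 𝕜} {f : 𝓓'((⊤ : Opens ℝ), 𝕜)}
    (hF : IsPrimitive F f) : 0 ≤ alexiewiczNorm f :=
  (norm_nonneg _).trans (hF.norm_sub_le (a := 0) (b := 0) (by simp [pi_pos.le]))

/-! ### Primitives and convolutions of integrable periodic functions. -/

theorem L1.intervalIntegrable {g : ℝ → 𝕜} (hg : g ∈ L1 𝕜) (a b : ℝ) :
    IntervalIntegrable g volume a b := by
  refine hg.1.intervalIntegrable two_pi_pos.ne' (t := -π) ?_ a b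
  rw [show -π + 2 * π = π by ring, intervalIntegrable_iff_integrableOn_Ico_of_le
    (by linarith [pi_pos])]
  exact hg.2

theorem mem_L1 {g : ℝ → 𝕜} (hp : Function.Periodic g (2 * π))
    (hg : IntervalIntegrable g volume (-π) π) : g ∈ L1 𝕜 :=
  ⟨hp, (intervalIntegrable_iff_integrableOn_Ico_of_le (by linarith [pi_pos])).mp hg⟩

theorem L1.locallyIntegrable {g : ℝ → 𝕜} (hg : g ∈ L1 𝕜) : LocallyIntegrable g :=
  fun x => ⟨Icc (x - 1) (x + 1), Icc_mem_nhds (by linarith) (by linarith),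
    (intervalIntegrable_iff_integrableOn_Icc_of_le (by linarith)).mp
      (L1.intervalIntegrable hg _ _)⟩

theorem L1.integral_mem_Bc {φ : ℝ → 𝕜} (hφ : φ ∈ L1 𝕜) :
    (fun x => ∫ t in (-π)..x, φ t) ∈ Bc 𝕜 := by
  refine mem_Bc (c := ∫ t in (-π)..π, φ t)
    (intervalIntegral.continuous_primitive (L1.intervalIntegrable hφ) _) (by simp) fun x => ?_
  rw [← intervalIntegral.integral_add_adjacent_intervals (L1.intervalIntegrable hφ (-π) x)
    (L1.intervalIntegrable hφ _ _), hφ.1.intervalIntegral_add_eq x (-π),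
    show -π + 2 * π = π by ring]

/-- Integration by parts against a test function. -/
theorem integral_deriv_smul_integral {φ : ℝ → 𝕜} (hφ : LocallyIntegrable φ) (a : ℝ) {ψ : ℝ → ℝ}
    (hψ : ContDiff ℝ 1 ψ) (hc : HasCompactSupport ψ) :
    ∫ x, deriv ψ x • ∫ t in a..x, φ t = -∫ x, ψ x • φ x := by
  have hi (c d : ℝ) : IntervalIntegrable φ volume c d :=
    (hφ.integrableOn_isCompact isCompact_uIcc).intervalIntegrable
  obtain ⟨R, hR⟩ := hc.isCompact.isBounded.subset_closedBall 0
  have hψ0 (x : ℝ) (hx : x ∉ Icc (-R) R) : ψ x = 0 := by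
    refine image_eq_zero_of_notMem_tsupport fun h => hx ?_
    simpa [Real.closedBall_eq_Icc] using hR h
  have hψ0' (x : ℝ) (hx : x ∉ Icc (-R) R) : deriv ψ x = 0 := by
    refine image_eq_zero_of_notMem_tsupport fun h => hx ?_
    simpa [Real.closedBall_eq_Icc] using hR (tsupport_deriv_subset h)
  have hdi : Integrable (deriv ψ) :=
    (hψ.continuous_deriv le_rfl).integrable_of_hasCompactSupport hc.deriv
  have hzero : ∫ x, deriv ψ x = 0 :=
    integral_eq_zero_of_hasDerivAt_of_integrable
      (fun x => (hψ.differentiable one_ne_zero x).hasDerivAt) hdi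
      (hψ.continuous.integrable_of_hasCompactSupport hc)
  -- Cutting `φ` off makes Fubini on `t ≤ x` legitimate. It moves the base point from `a` to `-R`,
  -- which is harmless since `deriv ψ` has integral zero.
  have hφi : Integrable ((Icc (-R) R).indicator φ) :=
    (integrable_indicator_iff measurableSet_Icc).mpr (hφ.integrableOn_isCompact isCompact_Icc)
  have hprod : Integrable (fun p : ℝ × ℝ =>
      {p : ℝ × ℝ | p.2 ≤ p.1}.indicator
        (fun p => deriv ψ p.1 • (Icc (-R) R).indicator φ p.2) p) (volume.prod volume) :=
    (hdi.smul_prod hφi).indicator (measurableSet_le measurable_snd measurable_fst)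
  have hinner (x : ℝ) : ∫ t, {p : ℝ × ℝ | p.2 ≤ p.1}.indicator
        (fun p => deriv ψ p.1 • (Icc (-R) R).indicator φ p.2) (x, t) =
      deriv ψ x • (∫ t in a..x, φ t) - deriv ψ x • ∫ t in a..(-R), φ t := by
    by_cases hx : x ∈ Icc (-R) R
    · rw [← smul_sub, intervalIntegral.integral_interval_sub_left (hi _ _) (hi _ _),
        intervalIntegral.integral_of_le hx.1, ← integral_Icc_eq_integral_Ioc,
        ← integral_smul, ← integral_indicator measurableSet_Icc]
      congr 1
      ext t
      by_cases h1 : t ≤ x <;> by_cases h2 : -R ≤ t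
      · simp [indicator, h1, h2, h1.trans hx.2]
      all_goals simp [indicator, h1, h2]
    · simp [hψ0' x hx, indicator]
  have houter (t : ℝ) : ∫ x, {p : ℝ × ℝ | p.2 ≤ p.1}.indicator
        (fun p => deriv ψ p.1 • (Icc (-R) R).indicator φ p.2) (x, t) = -(ψ t • φ t) := by
    have h1 : (fun x => {p : ℝ × ℝ | p.2 ≤ p.1}.indicator
        (fun p => deriv ψ p.1 • (Icc (-R) R).indicator φ p.2) (x, t)) =
        (Ici t).indicator fun x => deriv ψ x • (Icc (-R) R).indicator φ t := by
      ext x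
      by_cases h : t ≤ x <;> simp [indicator, h]
    rw [h1, integral_indicator measurableSet_Ici, integral_smul_const,
      integral_Ici_eq_integral_Ioi,
      hc.integral_Ioi_deriv_eq hψ, neg_smul]
    by_cases ht : t ∈ Icc (-R) R
    · rw [indicator_of_mem ht]
    · simp [hψ0 t ht]
  have hswap := integral_integral_swap (f := fun x t => {p : ℝ × ℝ | p.2 ≤ p.1}.indicator
        (fun p => deriv ψ p.1 • (Icc (-R) R).indicator φ p.2) (x, t)) hprod
  simp only [hinner, houter, integral_neg] at hswap
  rw [← hswap, integral_sub, integral_smul_const, hzero, zero_smul, sub_zero]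
  · exact ((intervalIntegral.continuous_primitive hi a).locallyIntegrable
      ).integrable_smul_left_of_hasCompactSupport (hψ.continuous_deriv le_rfl) hc.deriv
  · exact hdi.smul_const _

theorem L1.isPrimitive {φ : ℝ → 𝕜} (hφ : φ ∈ L1 𝕜) :
    IsPrimitive (fun x => ∫ t in (-π)..x, φ t) (toDistribution φ) := by
  have hB := L1.integral_mem_Bc hφ
  refine ⟨hB, DFunLike.ext _ _ fun ψ => ?_⟩
  rw [derivative_apply, toDistribution_apply hB.1.locallyIntegrable,
    toDistribution_apply (L1.locallyIntegrable hφ)]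
  simp only [testFunction_deriv_apply]
  rw [integral_deriv_smul_integral (L1.locallyIntegrable hφ) _
    (ψ.contDiff.of_le (by exact_mod_cast le_top)) ψ.hasCompactSupport, neg_neg]

/-- On a bounded rectangle both factors may be replaced by their restrictions to bounded intervals,
which are integrable on the line; their convolution integrand is then jointly integrable. -/
theorem L1.integrableOn_conv {φ g : ℝ → 𝕜} (hφ : φ ∈ L1 𝕜) (hg : g ∈ L1 𝕜) (a b c d : ℝ) :
    IntegrableOn (Function.uncurry fun x t => φ (x - t) * g t) (uIoc a b ×ˢ uIoc c d) := by
  obtain ⟨M, hM⟩ : ∃ M, ∀ x ∈ uIoc a b, ∀ t ∈ uIoc c d, x - t ∈ uIoc (-M) M := by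
    refine ⟨|a| + |b| + |c| + |d| + 1, fun x hx t ht => ?_⟩
    rw [mem_uIoc] at *
    left
    have := abs_le.mp (le_refl |a|)
    have := abs_le.mp (le_refl |b|)
    have := abs_le.mp (le_refl |c|)
    have := abs_le.mp (le_refl |d|)
    rcases hx with hx | hx <;> rcases ht with ht | ht <;> constructor <;>
      linarith [hx.1, hx.2, ht.1, ht.2, abs_nonneg a, abs_nonneg b, abs_nonneg c, abs_nonneg d]
  have h1 : Integrable ((uIoc (-M) M).indicator φ) :=
    (integrable_indicator_iff measurableSet_uIoc).mpr
      (intervalIntegrable_iff.mp (L1.intervalIntegrable hφ _ _))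
  have h2 : Integrable ((uIoc c d).indicator g) :=
    (integrable_indicator_iff measurableSet_uIoc).mpr
      (intervalIntegrable_iff.mp (L1.intervalIntegrable hg _ _))
  refine ((h2.convolution_integrand (ContinuousLinearMap.mul ℝ 𝕜) h1).integrableOn).congr_fun ?_
    (measurableSet_uIoc.prod measurableSet_uIoc)
  rintro ⟨x, t⟩ ⟨hx, ht⟩
  simp only [ContinuousLinearMap.mul_apply', Function.uncurry_apply_pair]
  rw [indicator_of_mem ht, indicator_of_mem (hM x hx t ht), mul_comm]

theorem L1.conv_mem {φ g : ℝ → 𝕜} (hφ : φ ∈ L1 𝕜) (hg : g ∈ L1 𝕜) : conv φ g ∈ L1 𝕜 := by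
  refine mem_L1 (fun x => ?_) ?_
  · simp only [conv, add_sub_right_comm, hφ.1 _]
  · have h := L1.integrableOn_conv hφ hg (-π) π (-π) π
    rw [IntegrableOn, Measure.volume_eq_prod, ← Measure.prod_restrict] at h
    rw [intervalIntegrable_iff]
    refine (h.integral_prod_left).congr (Eventually.of_forall fun x => ?_)
    simp only [conv, Function.uncurry_apply_pair]
    rw [intervalIntegral.integral_of_le (by linarith [pi_pos]), uIoc_of_le (by linarith [pi_pos])]

theorem L1.integral_conv {φ g : ℝ → 𝕜} (hφ : φ ∈ L1 𝕜) (hg : g ∈ L1 𝕜) (a b : ℝ) :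
    ∫ x in a..b, conv φ g x = ∫ t in (-π)..π, (∫ x in (a - t)..(b - t), φ x) * g t := by
  simp only [conv]
  rw [intervalIntegral_intervalIntegral_swap (L1.integrableOn_conv hφ hg a b (-π) π)]
  simp only [intervalIntegral.integral_mul_const, intervalIntegral.integral_comp_sub_right]

/-! ### Convolution on the level of primitives. -/

/-- The primitive, vanishing at `-π`, of the convolution of `g` with the derivative of `H`. -/
noncomputable def convPrimitive (g H : ℝ → 𝕜) (x : ℝ) : 𝕜 :=
  ∫ t in (-π)..π, (H (x - t) - H (-π - t)) * g t

theorem L1.intervalIntegrable_mul {g : ℝ → 𝕜} (hg : g ∈ L1 𝕜) {E : ℝ → 𝕜} (hE : Continuous E)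
    (a b : ℝ) : IntervalIntegrable (fun t => E t * g t) volume a b :=
  (L1.intervalIntegrable hg a b).continuousOn_mul hE.continuousOn

theorem convPrimitive_sub {g H : ℝ → 𝕜} (hg : g ∈ L1 𝕜) (hH : Continuous H) (a b : ℝ) :
    convPrimitive g H b - convPrimitive g H a =
      ∫ t in (-π)..π, (H (b - t) - H (a - t)) * g t := by
  rw [convPrimitive, convPrimitive, ← intervalIntegral.integral_sub
    (L1.intervalIntegrable_mul hg (by fun_prop) _ _)
    (L1.intervalIntegrable_mul hg (by fun_prop) _ _)]
  congr 1
  ext t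
  ring

theorem convPrimitive_sub_right {g G H : ℝ → 𝕜} (hg : g ∈ L1 𝕜) (hG : Continuous G)
    (hH : Continuous H) : convPrimitive g (G - H) = convPrimitive g G - convPrimitive g H := by
  ext x
  simp only [convPrimitive, Pi.sub_apply]
  rw [← intervalIntegral.integral_sub
    (L1.intervalIntegrable_mul hg (by fun_prop) _ _)
    (L1.intervalIntegrable_mul hg (by fun_prop) _ _)]
  congr 1
  ext t
  ring

theorem L1.norm_integral_mul_le {g : ℝ → 𝕜} (hg : g ∈ L1 𝕜) {E : ℝ → 𝕜} {C : ℝ}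
    (hC : ∀ t, ‖E t‖ ≤ C) :
    ‖∫ t in (-π)..π, E t * g t‖ ≤ C * ∫ t in (-π)..π, ‖g t‖ := by
  rw [← intervalIntegral.integral_const_mul]
  refine intervalIntegral.norm_integral_le_of_norm_le (by linarith [pi_pos])
    (Eventually.of_forall fun t _ => ?_) ((L1.intervalIntegrable hg _ _).norm.const_mul C)
  rw [norm_mul]
  exact mul_le_mul_of_nonneg_right (hC t) (norm_nonneg _)

theorem convPrimitive_mem_Bc {g H : ℝ → 𝕜} (hg : g ∈ L1 𝕜) (hH : H ∈ Bc 𝕜) :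
    convPrimitive g H ∈ Bc 𝕜 := by
  refine mem_Bc (c := ∫ t in (-π)..π, H π * g t) ?_ (by simp [convPrimitive]) fun x => ?_
  · have hI : 0 ≤ ∫ t in (-π)..π, ‖g t‖ :=
      intervalIntegral.integral_nonneg (by linarith [pi_pos]) fun _ _ => norm_nonneg _
    rw [Metric.continuous_iff]
    intro a ε hε
    obtain ⟨δ, hδ, h⟩ := Metric.uniformContinuous_iff.mp (Bc.uniformContinuous hH)
      (ε / ((∫ t in (-π)..π, ‖g t‖) + 1)) (by positivity)
    refine ⟨δ, hδ, fun b hb => ?_⟩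
    rw [dist_eq_norm, convPrimitive_sub hg hH.1]
    refine (L1.norm_integral_mul_le hg (C := ε / ((∫ t in (-π)..π, ‖g t‖) + 1)) fun t => ?_).trans_lt
      ?_
    · rw [← dist_eq_norm]
      exact (h (by simpa [dist_eq_norm] using hb)).le
    · rw [div_mul_eq_mul_div, div_lt_iff₀ (by positivity)]
      nlinarith
  · rw [← sub_eq_iff_eq_add', convPrimitive_sub hg hH.1]
    simp only [add_sub_right_comm, Bc.add_two_pi hH, sub_self, zero_add]

theorem L1.isPrimitive_conv {φ g : ℝ → 𝕜} (hφ : φ ∈ L1 𝕜) (hg : g ∈ L1 𝕜) :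
    IsPrimitive (convPrimitive g fun x => ∫ t in (-π)..x, φ t) (toDistribution (conv φ g)) := by
  convert! L1.isPrimitive (L1.conv_mem hφ hg) using 1
  ext x
  rw [L1.integral_conv hφ hg]
  simp only [convPrimitive]
  congr 1
  ext t
  rw [intervalIntegral.integral_interval_sub_left (L1.intervalIntegrable hφ _ _)
    (L1.intervalIntegrable hφ _ _)]

/-- An increment of the primitive of the error averages, against `g`, increments of the same length
of the primitive of `φ k - h`. The error is thus at most the norm of `φ k - h` times the `L¹` norm
of `g`. -/
theorem isConvolution_of_isPrimitive {g H : ℝ → 𝕜} {h u : 𝓓'((⊤ : Opens ℝ), 𝕜)}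
    (hg : g ∈ L1 𝕜) (hH : IsPrimitive H h) (hu : IsPrimitive (convPrimitive g H) u) :
    IsConvolution g h u := by
  refine ⟨⟨_, hu⟩, fun φ hφ hlim => ?_⟩
  have hprim (k : ℕ) := (L1.isPrimitive (hφ k)).sub hH
  have hprim' (k : ℕ) := (L1.isPrimitive_conv (hφ k) hg).sub hu
  refine squeeze_zero (fun k => (hprim' k).alexiewiczNorm_nonneg) (fun k => ?_)
    (by simpa using hlim.mul_const (∫ t in (-π)..π, ‖g t‖))
  refine (hprim' k).alexiewiczNorm_le fun a b hab => ?_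
  have hΦ := (L1.integral_mem_Bc (hφ k)).1
  rw [← convPrimitive_sub_right hg hΦ hH.1.1, convPrimitive_sub hg (hΦ.sub hH.1.1)]
  exact L1.norm_integral_mul_le hg fun t => (hprim k).norm_sub_le (by simpa using hab)

/-! ### Density of `L¹` and uniqueness of the convolution. -/

/-- `L¹(𝕋)` is dense in `A_c(𝕋)` for the Alexiewicz norm. -/
theorem exists_L1_tendsto {h : 𝓓'((⊤ : Opens ℝ), 𝕜)} (hh : h ∈ Ac 𝕜) :
    ∃ φ : ℕ → ℝ → 𝕜, (∀ k, φ k ∈ L1 𝕜) ∧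
      Tendsto (fun k => alexiewiczNorm (toDistribution (φ k) - h)) atTop (𝓝 0) := by
  obtain ⟨H, hH⟩ := hh
  have hc := hH.1.1
  have hi (a b : ℝ) : IntervalIntegrable H volume a b := hc.intervalIntegrable a b
  -- Difference quotients of `H`: up to a constant, their primitives are the averages of `H` over
  -- `[x, x + 1 / (k + 1)]`, which tend to `H` uniformly.
  let φ : ℕ → ℝ → 𝕜 := fun k x => ((k : ℝ) + 1) • (H (x + 1 / ((k : ℝ) + 1)) - H x)
  have hφ (k : ℕ) : φ k ∈ L1 𝕜 := by
    refine mem_L1 (fun x => ?_) (Continuous.intervalIntegrable (by fun_prop) _ _)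
    simp only [φ, add_right_comm x (2 * π), Bc.add_two_pi hH.1, add_sub_add_right_eq_sub]
  refine ⟨φ, hφ, Metric.tendsto_atTop.mpr fun ε hε => ?_⟩
  obtain ⟨δ, hδ, hunif⟩ := Metric.uniformContinuous_iff.mp (Bc.uniformContinuous hH.1)
    (ε / 4) (by positivity)
  obtain ⟨N, hN⟩ := exists_nat_one_div_lt hδ
  refine ⟨N, fun k hk => ?_⟩
  have hprim := (L1.isPrimitive (hφ k)).sub hH
  rw [Real.dist_0_eq_abs, abs_of_nonneg hprim.alexiewiczNorm_nonneg]
  refine (hprim.alexiewiczNorm_le (C := ε / 2) fun a b _ => ?_).trans_lt (by linarith)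
  set η : ℝ := 1 / ((k : ℝ) + 1) with hη
  have hη0 : 0 < η := by positivity
  have hηδ : η < δ := (one_div_le_one_div_of_le (by positivity)
    (by exact_mod_cast Nat.succ_le_succ hk)).trans_lt hN
  have hkη : ((k : ℝ) + 1) * η = 1 := by rw [hη]; field_simp
  have hmean (x : ℝ) : ‖((k : ℝ) + 1) • (∫ t in x..(x + η), H t) - H x‖ ≤ ε / 4 := by
    have e : ((k : ℝ) + 1) • (∫ t in x..(x + η), H t) - H x =
        ((k : ℝ) + 1) • ∫ t in x..(x + η), (H t - H x) := by
      rw [intervalIntegral.integral_sub (hi _ _) _root_.intervalIntegrable_const,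
        intervalIntegral.integral_const, smul_sub, smul_smul, add_sub_cancel_left, hkη, one_smul]
    have h1 : ‖∫ t in x..(x + η), (H t - H x)‖ ≤ ε / 4 * |x + η - x| := by
      refine intervalIntegral.norm_integral_le_of_norm_le_const fun t ht => ?_
      rw [uIoc_of_le (by linarith)] at ht
      rw [← dist_eq_norm]
      refine (hunif ?_).le
      rw [Real.dist_eq, abs_of_pos (by linarith [ht.1])]
      linarith [ht.2]
    rw [add_sub_cancel_left, abs_of_pos hη0] at h1
    rw [e, norm_smul, Real.norm_of_nonneg (by positivity)]
    calc ((k : ℝ) + 1) * _ ≤ ((k : ℝ) + 1) * (ε / 4 * η) := by gcongr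
      _ = ε / 4 * (((k : ℝ) + 1) * η) := by ring
      _ = ε / 4 := by rw [hkη, mul_one]
  have e : ((fun x => ∫ t in (-π)..x, φ k t) - H) b - ((fun x => ∫ t in (-π)..x, φ k t) - H) a =
      (((k : ℝ) + 1) • (∫ t in b..(b + η), H t) - H b) -
        (((k : ℝ) + 1) • (∫ t in a..(a + η), H t) - H a) := by
    have h1 : (∫ t in (-π)..b, φ k t) - ∫ t in (-π)..a, φ k t =
        ((k : ℝ) + 1) • ((∫ t in b..(b + η), H t) - ∫ t in a..(a + η), H t) := by
      rw [intervalIntegral.integral_interval_sub_left (L1.intervalIntegrable (hφ k) _ _)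
        (L1.intervalIntegrable (hφ k) _ _)]
      simp only [φ]
      rw [intervalIntegral.integral_smul, intervalIntegral.integral_sub
        (Continuous.intervalIntegrable (by fun_prop) _ _) (hi _ _),
        intervalIntegral.integral_comp_add_right,
        ← intervalIntegral.integral_interval_sub_interval_comm' (hi _ _) (hi _ _) (hi _ _)]
    simp only [Pi.sub_apply]
    rw [sub_sub_sub_comm, h1, smul_sub]
    abel
  rw [e]
  refine (norm_sub_le _ _).trans ?_
  linarith [hmean a, hmean b]

theorem IsConvolution.unique {g : ℝ → 𝕜} {h u v : 𝓓'((⊤ : Opens ℝ), 𝕜)} (hh : h ∈ Ac 𝕜)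
    (hg : g ∈ L1 𝕜) (hu : IsConvolution g h u) (hv : IsConvolution g h v) : u = v := by
  obtain ⟨φ, hφ, hlim⟩ := exists_L1_tendsto hh
  have h1 := hu.2 φ hφ hlim
  have h2 := hv.2 φ hφ hlim
  obtain ⟨U, hU⟩ := hu.1
  obtain ⟨V, hV⟩ := hv.1
  have hp (k : ℕ) := L1.isPrimitive_conv (hφ k) hg
  have key (a b : ℝ) (hab : |b - a| ≤ 2 * π) : U b - U a = V b - V a := by
    rw [← sub_eq_zero, ← norm_le_zero_iff]
    refine ge_of_tendsto' (by simpa using h1.add h2) fun k => ?_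
    have e : U b - U a - (V b - V a) =
        ((convPrimitive g (fun x => ∫ t in (-π)..x, φ k t) - V) b -
          (convPrimitive g (fun x => ∫ t in (-π)..x, φ k t) - V) a) -
        ((convPrimitive g (fun x => ∫ t in (-π)..x, φ k t) - U) b -
          (convPrimitive g (fun x => ∫ t in (-π)..x, φ k t) - U) a) := by
      simp only [Pi.sub_apply]
      ring
    rw [e]
    refine (norm_sub_le _ _).trans ?_
    linarith [((hp k).sub hU).norm_sub_le hab, ((hp k).sub hV).norm_sub_le hab]
  -- The norm only controls increments over lengths up to `2π`. The full length gives periodicity,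
  -- and increments from `-π` settle one period.
  have hper : Function.Periodic (U - V) (2 * π) := fun x => by
    have := key x (x + 2 * π) (by simp [abs_of_pos pi_pos])
    simp only [Pi.sub_apply]
    linear_combination this
  have hUV : U = V := by
    ext x
    obtain ⟨y, hy, he⟩ := hper.exists_mem_Ico two_pi_pos x (-π)
    have := key (-π) y (by rw [abs_le]; constructor <;> linarith [hy.1, hy.2, pi_pos])
    rw [hU.1.2.1, hV.1.2.1, sub_zero, sub_zero] at this
    rw [← sub_eq_zero]
    exact he.trans (by simp [this])
  rw [← hU.2, ← hV.2, hUV]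

/-! ### Cohen factorization. -/

/-- Neumann series for `2 - S = 2 (1 - S / 2)`. -/
theorem exists_two_smul_sub {A : Type*} [NormedAddCommGroup A] [NormedSpace ℝ A] [CompleteSpace A]
    (S : A →L[ℝ] A) (hS : ‖S‖ ≤ 1) (a : A) : ∃ b, (2 : ℝ) • b - S b = a := by
  have h : ‖(2⁻¹ : ℝ) • S‖ < 1 := by
    rw [norm_smul]
    norm_num
    linarith
  refine ⟨(2⁻¹ : ℝ) • ((Units.oneSub _ h)⁻¹ : (A →L[ℝ] A)ˣ).1 a, ?_⟩
  have h1 := congrArg (fun T : A →L[ℝ] A => T a) (Units.oneSub _ h).mul_inv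
  simp only [Units.val_oneSub, mul_apply_eq_comp, sub_apply,
    one_apply_eq_self, smul_apply] at h1
  rw [map_smul, smul_smul, mul_inv_cancel₀ two_ne_zero, one_smul]
  exact h1

theorem norm_le_of_two_smul_sub {A : Type*} [NormedAddCommGroup A] [NormedSpace ℝ A]
    {S : A →L[ℝ] A} (hS : ‖S‖ ≤ 1) {a : A} {C : ℝ} (h : ‖(2 : ℝ) • a - S a‖ ≤ C) : ‖a‖ ≤ C := by
  have h1 : ‖(2 : ℝ) • a‖ - ‖S a‖ ≤ C := (norm_sub_norm_le _ _).trans h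
  have h2 : ‖S a‖ ≤ ‖a‖ := (S.le_of_opNorm_le hS a).trans (one_mul _).le
  rw [norm_smul] at h1
  norm_num at h1
  linarith

/-- A form of Cohen's factorization theorem. The Banach space `A` acts on the Banach space `X`
through the bilinear forms `B i`, the `i`-th coordinate of an element of `X` being given by `ev i`.
Approximate units `e` with operators `S` on `A` and `T` on `X` implementing their action give
a factorization of every element of `X`. -/
theorem exists_factorization {A X E ι : Type*} [NormedAddCommGroup A] [NormedSpace ℝ A]
    [CompleteSpace A] [NormedAddCommGroup X] [NormedSpace ℝ X] [CompleteSpace X]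
    [NormedAddCommGroup E] [NormedSpace ℝ E] (B : ι → A →L[ℝ] X →L[ℝ] E) (ev : ι → X →L[ℝ] E)
    (H : ∀ (a : A) (x : X) (ε : ℝ), 0 < ε → ∃ (e : A) (S : A →L[ℝ] A) (T : X →L[ℝ] X),
      ‖e‖ ≤ 1 ∧ ‖S‖ ≤ 1 ∧ ‖S a - a‖ ≤ ε ∧ ‖T x - x‖ ≤ ε ∧
      (∀ i a x, B i (S a) x = B i a (T x)) ∧ ∀ i x, ev i (T x) = B i e x) (G : X) :
    ∃ (a : A) (x : X), ∀ i, ev i G = B i a x := by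
  have step (n : ℕ) (p : A × X) : ∃ q : A × X, ‖q.1 - p.1‖ ≤ 2 * (1 / 2) ^ n ∧
      ‖q.2 - p.2‖ ≤ 2 * (1 / 2) ^ n ∧
      ∀ i, ((1 : ℝ) / 2) ^ (n + 1) • ev i q.2 + B i q.1 q.2 =
        ((1 : ℝ) / 2) ^ n • ev i p.2 + B i p.1 p.2 := by
    obtain ⟨a, x⟩ := p
    obtain ⟨e, S, T, he, hS, hSa, hTx, hB, hev⟩ := H a x ((1 / 2) ^ n) (by positivity)
    -- In the unitization of `A` this is `2⁻⁽ⁿ⁺¹⁾ + b = (2 - e)⁻¹ (2⁻ⁿ + a)`, while `x` is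
    -- multiplied by `2 - e`. The product is unchanged, and the scalar part is halved.
    obtain ⟨b, hb⟩ := exists_two_smul_sub S hS (a + ((1 : ℝ) / 2) ^ (n + 1) • e)
    have hpow : ((1 : ℝ) / 2) ^ (n + 1) = (1 / 2) ^ n / 2 := by ring
    have hpos : (0 : ℝ) < (1 / 2) ^ n := by positivity
    refine ⟨(b, (2 : ℝ) • x - T x), ?_, ?_, fun i => ?_⟩
    · refine norm_le_of_two_smul_sub hS ?_
      have h1 : (2 : ℝ) • (b - a) - S (b - a) = (S a - a) + ((1 : ℝ) / 2) ^ (n + 1) • e := by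
        rw [map_sub, smul_sub, sub_sub_sub_comm, hb]
        module
      dsimp only
      rw [h1]
      refine (norm_add_le _ _).trans ?_
      have h2 : ‖((1 : ℝ) / 2) ^ (n + 1) • e‖ ≤ (1 / 2) ^ (n + 1) := by
        rw [norm_smul, Real.norm_of_nonneg (by positivity)]
        exact mul_le_of_le_one_right (by positivity) he
      linarith
    · have h1 : (2 : ℝ) • x - T x - x = -(T x - x) := by module
      dsimp only
      rw [h1, norm_neg]
      linarith
    · have h1 : B i b ((2 : ℝ) • x - T x) = B i ((2 : ℝ) • b - S b) x := by
        simp only [map_sub, map_smul, sub_apply,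
          smul_apply, hB]
      dsimp only
      rw [h1, hb]
      simp only [map_add, map_sub, map_smul, add_apply,
        smul_apply, hev, hpow]
      module
  choose next h1 h2 h3 using step
  let u : ℕ → A × X := fun n => Nat.rec (0, G) next n
  have hu (n : ℕ) : u (n + 1) = next n (u n) := rfl
  have c1 : CauchySeq fun n => (u n).1 :=
    cauchySeq_of_le_geometric (1 / 2) 2 (by norm_num) fun n => by
      rw [dist_comm, dist_eq_norm, hu]
      exact h1 n (u n)
  have c2 : CauchySeq fun n => (u n).2 :=
    cauchySeq_of_le_geometric (1 / 2) 2 (by norm_num) fun n => by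
      rw [dist_comm, dist_eq_norm, hu]
      exact h2 n (u n)
  obtain ⟨a, ha⟩ := cauchySeq_tendsto_of_complete c1
  obtain ⟨x, hx⟩ := cauchySeq_tendsto_of_complete c2
  refine ⟨a, x, fun i => ?_⟩
  -- The element `2⁻ⁿ + aₙ` of the unitization, acting on `xₙ`, always gives `G`; in the limit the
  -- scalar part disappears.
  have inv (n : ℕ) : ((1 : ℝ) / 2) ^ n • ev i (u n).2 + B i (u n).1 (u n).2 = ev i G := by
    induction n with
    | zero => simp [u]
    | succ n ih => rw [hu, h3, ih]
  have t1 : Tendsto (fun n => ((1 : ℝ) / 2) ^ n • ev i (u n).2 + B i (u n).1 (u n).2) atTop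
      (𝓝 ((0 : ℝ) • ev i x + B i a x)) :=
    ((tendsto_pow_atTop_nhds_zero_of_lt_one (by norm_num) (by norm_num)).smul
      (((ev i).continuous.tendsto x).comp hx)).add
      (((B i).continuous₂.tendsto (a, x)).comp (ha.prodMk_nhds hx))
  simp only [inv, zero_smul, zero_add] at t1
  exact tendsto_nhds_unique tendsto_const_nhds t1

/-! ### Averages of strongly continuous families of contractions. -/

/-- The average `δ⁻¹ ∫₀^δ τ s y ds` of a strongly continuous family of contractions. -/
noncomputable def average {Y : Type*} [NormedAddCommGroup Y] [NormedSpace ℝ Y]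
    (τ : ℝ → Y →L[ℝ] Y) (hτ : ∀ y, Continuous fun s => τ s y) (h1 : ∀ s, ‖τ s‖ ≤ 1) {δ : ℝ}
    (hδ : 0 < δ) : Y →L[ℝ] Y :=
  LinearMap.mkContinuous
    { toFun := fun y => δ⁻¹ • ∫ s in (0 : ℝ)..δ, τ s y
      map_add' := fun y z => by
        simp only [map_add]
        rw [intervalIntegral.integral_add ((hτ y).intervalIntegrable _ _)
          ((hτ z).intervalIntegrable _ _), smul_add]
      map_smul' := fun c y => by
        simp only [map_smul]
        rw [intervalIntegral.integral_smul, smul_comm, RingHom.id_apply] } 1 fun y => by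
    have h2 : ‖∫ s in (0 : ℝ)..δ, τ s y‖ ≤ ‖y‖ * |δ - 0| :=
      intervalIntegral.norm_integral_le_of_norm_le_const fun s _ =>
        ((τ s).le_of_opNorm_le (h1 s) y).trans (one_mul _).le
    rw [sub_zero, abs_of_pos hδ] at h2
    change ‖δ⁻¹ • ∫ s in (0 : ℝ)..δ, τ s y‖ ≤ _
    rw [norm_smul, norm_inv, Real.norm_of_nonneg hδ.le, one_mul, inv_mul_le_iff₀ hδ, mul_comm δ]
    exact h2

section average

variable {Y : Type*} [NormedAddCommGroup Y] [NormedSpace ℝ Y]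
  {τ : ℝ → Y →L[ℝ] Y} (hτ : ∀ y, Continuous fun s => τ s y) (h1 : ∀ s, ‖τ s‖ ≤ 1) {δ : ℝ}
  (hδ : 0 < δ)

theorem average_apply (y : Y) : average τ hτ h1 hδ y = δ⁻¹ • ∫ s in (0 : ℝ)..δ, τ s y := rfl

theorem norm_average_le : ‖average τ hτ h1 hδ‖ ≤ 1 :=
  LinearMap.mkContinuous_norm_le _ zero_le_one _

theorem map_average [CompleteSpace Y] {E : Type*} [NormedAddCommGroup E] [NormedSpace ℝ E]
    [CompleteSpace E]
    (L : Y →L[ℝ] E) (y : Y) :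
    L (average τ hτ h1 hδ y) = δ⁻¹ • ∫ s in (0 : ℝ)..δ, L (τ s y) := by
  rw [average_apply, map_smul, L.intervalIntegral_comp_comm ((hτ y).intervalIntegrable _ _)]

theorem norm_average_sub_le [CompleteSpace Y] {ε : ℝ} {y : Y}
    (h : ∀ s ∈ Set.Ioc 0 δ, ‖τ s y - y‖ ≤ ε) : ‖average τ hτ h1 hδ y - y‖ ≤ ε := by
  have h2 : average τ hτ h1 hδ y - y = δ⁻¹ • ∫ s in (0 : ℝ)..δ, (τ s y - y) := by
    rw [intervalIntegral.integral_sub ((hτ y).intervalIntegrable _ _)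
      _root_.intervalIntegrable_const, smul_sub, average_apply]
    simp [smul_smul, hδ.ne']
  have h3 : ‖∫ s in (0 : ℝ)..δ, (τ s y - y)‖ ≤ ε * |δ - 0| :=
    intervalIntegral.norm_integral_le_of_norm_le_const fun s hs =>
      h s (by rwa [Set.uIoc_of_le hδ.le] at hs)
  rw [sub_zero, abs_of_pos hδ] at h3
  rw [h2, norm_smul, norm_inv, Real.norm_of_nonneg hδ.le, inv_mul_le_iff₀ hδ, mul_comm δ]
  exact h3

end average

/-! ### Factorization of continuous functions on the circle. -/

section circle

variable {p : ℝ} [hp : Fact (0 < p)]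

/-- The translations of the circle as a continuous family of continuous maps. -/
def circleSub (p : ℝ) : C(ℝ, C(AddCircle p, AddCircle p)) :=
  ContinuousMap.curry
    ⟨fun q : ℝ × AddCircle p => q.2 - (q.1 : AddCircle p),
      continuous_snd.sub ((AddCircle.continuous_mk' p).comp continuous_fst)⟩

theorem measurePreserving_circleSub (s : ℝ) :
    MeasurePreserving (circleSub p s) (volume : Measure (AddCircle p)) volume :=
  measurePreserving_sub_right volume (s : AddCircle p)

variable (𝕜) in
/-- Translation of continuous functions on the circle. -/
noncomputable def translateC (s : ℝ) : C(AddCircle p, 𝕜) →L[ℝ] C(AddCircle p, 𝕜) :=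
  LinearMap.mkContinuous
    { toFun := fun K => K.comp (circleSub p s)
      map_add' := fun _ _ => rfl
      map_smul' := fun _ _ => rfl } 1 fun K => by
    rw [one_mul]
    exact (ContinuousMap.norm_le _ (norm_nonneg _)).mpr fun x => K.norm_coe_le_norm _

theorem translateC_apply (s : ℝ) (K : C(AddCircle p, 𝕜)) (x : AddCircle p) :
    translateC 𝕜 s K x = K (x - s) := rfl

theorem norm_translateC_le (s : ℝ) : ‖translateC (p := p) 𝕜 s‖ ≤ 1 :=
  LinearMap.mkContinuous_norm_le _ zero_le_one _

theorem continuous_translateC (K : C(AddCircle p, 𝕜)) : Continuous fun s => translateC 𝕜 s K :=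
  (ContinuousMap.continuous_postcomp K).comp (circleSub p).continuous

variable (𝕜) in
/-- Translation of integrable functions on the circle. -/
noncomputable def translateLp (s : ℝ) :
    Lp 𝕜 1 (volume : Measure (AddCircle p)) →L[ℝ] Lp 𝕜 1 (volume : Measure (AddCircle p)) :=
  (Lp.compMeasurePreservingₗᵢ ℝ _ (measurePreserving_circleSub s)).toContinuousLinearMap

theorem coeFn_translateLp (s : ℝ) (g : Lp 𝕜 1 (volume : Measure (AddCircle p))) :
    translateLp 𝕜 s g =ᵐ[volume] fun t => g (t - s) :=
  Lp.coeFn_compMeasurePreserving g (measurePreserving_circleSub s)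

theorem norm_translateLp_le (s : ℝ) : ‖translateLp (p := p) 𝕜 s‖ ≤ 1 :=
  LinearIsometry.norm_toContinuousLinearMap_le _

theorem continuous_translateLp (g : Lp 𝕜 1 (volume : Measure (AddCircle p))) :
    Continuous fun s => translateLp 𝕜 s g :=
  (continuous_const (y := g)).compMeasurePreservingLp (circleSub p).continuous
    measurePreserving_circleSub ENNReal.one_ne_top

theorem integrable_mul_comp_sub {g : AddCircle p → 𝕜} (hg : Integrable g)
    (K : C(AddCircle p, 𝕜)) (x : AddCircle p) : Integrable fun t => g t * K (x - t) :=
  hg.mul_bdd (c := ‖K‖) (by fun_prop)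
    (Eventually.of_forall fun t => K.norm_coe_le_norm _)

variable (𝕜) in
/-- The value at `x` of the convolution of an integrable and a continuous function. -/
noncomputable def circleConv (x : AddCircle p) :
    Lp 𝕜 1 (volume : Measure (AddCircle p)) →L[ℝ] C(AddCircle p, 𝕜) →L[ℝ] 𝕜 :=
  LinearMap.mkContinuous₂
    (LinearMap.mk₂ ℝ (fun g K => ∫ t, g t * K (x - t))
      (fun g₁ g₂ K => by
        rw [← integral_add (integrable_mul_comp_sub (L1.integrable_coeFn g₁) K x)
          (integrable_mul_comp_sub (L1.integrable_coeFn g₂) K x)]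
        refine integral_congr_ae ?_
        filter_upwards [Lp.coeFn_add g₁ g₂] with t ht
        rw [ht, Pi.add_apply, add_mul])
      (fun c g K => by
        rw [← integral_smul]
        refine integral_congr_ae ?_
        filter_upwards [Lp.coeFn_smul c g] with t ht
        rw [ht, Pi.smul_apply, smul_mul_assoc])
      (fun g K₁ K₂ => by
        rw [← integral_add (integrable_mul_comp_sub (L1.integrable_coeFn g) K₁ x)
          (integrable_mul_comp_sub (L1.integrable_coeFn g) K₂ x)]
        simp [mul_add])
      (fun c g K => by
        rw [← integral_smul]
        simp)) 1 fun g K => by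
    rw [LinearMap.mk₂_apply, one_mul, L1.norm_eq_integral_norm, ← integral_mul_const]
    refine norm_integral_le_of_norm_le ((L1.integrable_coeFn g).norm.mul_const _)
      (Eventually.of_forall fun t => ?_)
    rw [norm_mul]
    exact mul_le_mul_of_nonneg_left (K.norm_coe_le_norm _) (norm_nonneg _)

theorem circleConv_apply (x : AddCircle p) (g : Lp 𝕜 1 (volume : Measure (AddCircle p)))
    (K : C(AddCircle p, 𝕜)) : circleConv 𝕜 x g K = ∫ t, g t * K (x - t) := rfl

/-- Invariance of the measure moves a translation from one factor to the other. Averaged over `s`,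
this is the compatibility of `S` and `T` required in `exists_factorization`. -/
theorem circleConv_translate (x : AddCircle p) (g : Lp 𝕜 1 (volume : Measure (AddCircle p)))
    (K : C(AddCircle p, 𝕜)) (s : ℝ) :
    circleConv 𝕜 x (translateLp 𝕜 s g) K = circleConv 𝕜 x g (translateC 𝕜 s K) := by
  rw [circleConv_apply, circleConv_apply,
    ← integral_sub_right_eq_self (fun t => g t * translateC 𝕜 s K (x - t)) (s : AddCircle p)]
  refine integral_congr_ae ?_
  filter_upwards [coeFn_translateLp s g] with t ht
  rw [ht, translateC_apply]
  congr 2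
  abel

/-- The function `δ⁻¹ 1_{(0, δ]}` on the circle. -/
noncomputable def circleKernel (p δ : ℝ) [Fact (0 < p)] : AddCircle p → ℝ :=
  AddCircle.liftIoc p 0 ({x | x ≤ δ}.indicator fun _ => δ⁻¹)

theorem measurable_circleKernel (δ : ℝ) : Measurable (circleKernel p δ) := by
  have h : Measurable ({x : ℝ | x ≤ δ}.indicator fun _ => δ⁻¹) :=
    measurable_const.indicator measurableSet_Iic
  exact (h.comp measurable_subtype_coe).comp (AddCircle.measurableEquivIoc p 0).measurable

theorem circleKernel_nonneg {δ : ℝ} (hδ : 0 < δ) (t : AddCircle p) : 0 ≤ circleKernel p δ t :=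
  indicator_nonneg (fun _ _ => (inv_pos.mpr hδ).le) _

theorem norm_circleKernel_le {δ : ℝ} (hδ : 0 < δ) (t : AddCircle p) :
    ‖circleKernel p δ t‖ ≤ δ⁻¹ := by
  rw [Real.norm_of_nonneg (circleKernel_nonneg hδ t)]
  exact indicator_le_self' (fun _ _ => (inv_pos.mpr hδ).le) _

theorem integral_circleKernel_smul {E : Type*} [NormedAddCommGroup E] [NormedSpace ℝ E] {δ : ℝ}
    (hδ : 0 < δ) (hδp : δ ≤ p) (Q : AddCircle p → E) :
    ∫ t, circleKernel p δ t • Q t = δ⁻¹ • ∫ s in (0 : ℝ)..δ, Q s := by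
  rw [← AddCircle.intervalIntegral_preimage p 0, zero_add, ← intervalIntegral.integral_smul,
    ← intervalIntegral.integral_indicator ⟨hδ.le, hδp⟩]
  refine intervalIntegral.integral_congr_ae (Eventually.of_forall fun s hs => ?_)
  rw [uIoc_of_le hp.out.le] at hs
  rw [circleKernel, AddCircle.liftIoc_coe_apply (by rwa [zero_add])]
  by_cases h : s ≤ δ <;> simp [indicator, h]

/-- Every continuous function on the circle is the convolution of an integrable function and
a continuous one. -/
theorem exists_circleConv_eq (G : C(AddCircle p, 𝕜)) :
    ∃ (g : Lp 𝕜 1 (volume : Measure (AddCircle p))) (K : C(AddCircle p, 𝕜)),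
      ∀ x, G x = circleConv 𝕜 x g K := by
  refine exists_factorization (circleConv 𝕜) (fun x => ContinuousMap.evalCLM ℝ x)
    (fun g K ε hε => ?_) G
  have near {Y : Type _} [NormedAddCommGroup Y] {f : ℝ → Y} (hf : Continuous f) {y : Y}
      (h0 : f 0 = y) : ∃ δ > 0, ∀ s ∈ Ioc 0 δ, ‖f s - y‖ ≤ ε := by
    obtain ⟨δ, hδ, h⟩ := Metric.continuousAt_iff.mp (hf.continuousAt (x := 0)) ε hε
    refine ⟨δ / 2, by positivity, fun s hs => ?_⟩
    rw [← h0, ← dist_eq_norm]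
    refine (h ?_).le
    rw [Real.dist_0_eq_abs, abs_of_pos hs.1]
    linarith [hs.2]
  obtain ⟨δ₁, hδ₁, h₁⟩ := near (continuous_translateLp g) (y := g) (by
    refine Lp.ext ?_
    filter_upwards [coeFn_translateLp 0 g] with t ht
    simpa using ht)
  obtain ⟨δ₂, hδ₂, h₂⟩ := near (continuous_translateC K) (y := K) (by
    ext t
    simp [translateC_apply])
  -- The bound by `p` keeps `(0, δ]` within one period, so that the kernel has mass one.
  set δ := min p (min δ₁ δ₂)
  have hδ : 0 < δ := lt_min hp.out (lt_min hδ₁ hδ₂)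
  have hke : MemLp (fun t => (circleKernel p δ t : 𝕜)) 1 volume :=
    memLp_one_iff_integrable.mpr
      ((Integrable.of_bound (measurable_circleKernel δ).aestronglyMeasurable δ⁻¹
        (Eventually.of_forall fun t => norm_circleKernel_le hδ t)).ofReal)
  refine ⟨hke.toLp _, average (translateLp 𝕜) continuous_translateLp norm_translateLp_le hδ,
    average (translateC 𝕜) continuous_translateC norm_translateC_le hδ, ?_,
    norm_average_le _ _ _, norm_average_sub_le _ _ _ fun s hs => h₁ s ⟨hs.1, hs.2.trans ?_⟩,
    norm_average_sub_le _ _ _ fun s hs => h₂ s ⟨hs.1, hs.2.trans ?_⟩, fun x a y => ?_,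
    fun x y => ?_⟩
  · rw [L1.norm_eq_integral_norm]
    have e : (fun t => ‖hke.toLp _ t‖) =ᵐ[volume] fun t => circleKernel p δ t • (1 : ℝ) := by
      filter_upwards [hke.coeFn_toLp] with t ht
      rw [ht, RCLike.norm_ofReal, abs_of_nonneg (circleKernel_nonneg hδ t), smul_eq_mul, mul_one]
    rw [integral_congr_ae e, integral_circleKernel_smul hδ (min_le_left _ _)]
    simp [hδ.ne']
  · exact (min_le_right _ _).trans (min_le_left _ _)
  · exact (min_le_right _ _).trans (min_le_right _ _)
  · rw [map_average _ _ _ (circleConv 𝕜 x a)]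
    have := map_average continuous_translateLp norm_translateLp_le hδ
      ((circleConv 𝕜 x).flip y) a
    simp only [ContinuousLinearMap.flip_apply] at this
    rw [this]
    simp only [circleConv_translate]
  · rw [map_average, circleConv_apply]
    have e : (fun t => hke.toLp _ t * y (x - t)) =ᵐ[volume]
        fun t => circleKernel p δ t • y (x - t) := by
      filter_upwards [hke.coeFn_toLp] with t ht
      rw [ht, RCLike.real_smul_eq_coe_mul]
    rw [integral_congr_ae e, integral_circleKernel_smul hδ (min_le_left _ _)]
    rfl

end circle

/-! ### Factorization of primitives on the line. -/

/-- A continuous periodic function is the convolution of a function of `L¹(𝕋)` and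
a continuous periodic function. -/
theorem exists_integral_mul_eq {G : ℝ → 𝕜} (hG : Continuous G)
    (hp : Function.Periodic G (2 * π)) :
    ∃ g ∈ L1 𝕜, ∃ K : ℝ → 𝕜, Continuous K ∧ Function.Periodic K (2 * π) ∧
      (∀ x, G x = ∫ t in (-π)..π, K (x - t) * g t) ∧
      ∫ x in (-π)..π, G x = (∫ t in (-π)..π, g t) * ∫ t in (-π)..π, K t := by
  have : Fact (0 < 2 * π) := ⟨two_pi_pos⟩
  have hπ : -π + 2 * π = π := by ring
  have conv_int (E : AddCircle (2 * π) → 𝕜) : ∫ t in (-π)..π, E t = ∫ t, E t := by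
    rw [← AddCircle.intervalIntegral_preimage (2 * π) (-π), hπ]
  obtain ⟨g, K, h⟩ := exists_circleConv_eq
    (⟨hp.lift, continuous_coinduced_dom.mpr hG⟩ : C(AddCircle (2 * π), 𝕜))
  have hgi := L1.integrable_coeFn g
  have hKi : Integrable K := Integrable.of_bound K.continuous.aestronglyMeasurable ‖K‖
    (Eventually.of_forall K.norm_coe_le_norm)
  refine ⟨fun t => g t, mem_L1 (fun t => by simp) ?_, fun t => K t,
    K.continuous.comp (AddCircle.continuous_mk' _), fun t => by simp, fun x => ?_, ?_⟩
  · rw [intervalIntegrable_iff_integrableOn_Ioc_of_le (by linarith [pi_pos])]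
    have := (AddCircle.measurePreserving_mk (2 * π) (-π)).integrable_comp_of_integrable hgi
    rwa [hπ] at this
  · refine (h x).trans ?_
    rw [circleConv_apply, ← conv_int]
    simp [mul_comm]
  · rw [conv_int fun t => g t, conv_int fun t => K t]
    -- The integral of a convolution is the product of the integrals; this is what later shows that
    -- `g` has nonzero integral.
    have h1 := integral_convolution (ContinuousLinearMap.mul ℝ 𝕜) hgi hKi
    rw [ContinuousLinearMap.mul_apply'] at h1
    rw [← h1, ← conv_int]
    exact intervalIntegral.integral_congr fun x _ => h x

theorem exists_convPrimitive_eq {F : ℝ → 𝕜} (hF : F ∈ Bc 𝕜) :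
    ∃ g ∈ L1 𝕜, ∃ H ∈ Bc 𝕜, convPrimitive g H = F := by
  have hπ : (π : 𝕜) ≠ 0 := RCLike.ofReal_ne_zero.mpr pi_ne_zero
  set c := F π / (2 * π) with hc
  set G₀ : ℝ → 𝕜 := fun x => F x - c * (x + π) with hG₀
  have hG₀c : Continuous G₀ := hF.1.sub (by fun_prop)
  -- Chosen so that `G₀ + s` has integral `1` over a period. The constant cancels again in
  -- `convPrimitive`, which only sees increments.
  set s : 𝕜 := (1 - ∫ x in (-π)..π, G₀ x) / (2 * π) with hs
  obtain ⟨g, hg, K, hK, hKp, hconv, hint⟩ := exists_integral_mul_eq (G := fun x => G₀ x + s)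
    (hG₀c.add continuous_const) fun x => by simp only [Bc.periodic hF x, hG₀, hc]
  have hm : ∫ t in (-π)..π, g t ≠ 0 := by
    intro h0
    rw [h0, zero_mul, intervalIntegral.integral_add (hG₀c.intervalIntegrable _ _)
      _root_.intervalIntegrable_const, intervalIntegral.integral_const,
      RCLike.real_smul_eq_coe_mul, hs] at hint
    push_cast at hint
    field_simp at hint
    ring_nf at hint
    exact two_ne_zero hint
  set m := ∫ t in (-π)..π, g t with hm_def
  -- Convolution with `g` multiplies the slope by `m`, so slope `c / m` yields the affine part `c *
  -- (x + π)`; `K (-π)` is subtracted to vanish at `-π`.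
  refine ⟨g, hg, fun x => K x - K (-π) + c / m * (x + π),
    mem_Bc (c := c / m * (2 * π)) (by fun_prop) (by simp) fun x => ?_, ?_⟩
  · rw [hKp]
    push_cast
    ring
  · ext x
    have e : convPrimitive g (fun x => K x - K (-π) + c / m * (x + π)) x =
        ∫ t in (-π)..π, (K (x - t) * g t - K (-π - t) * g t + c / m * (x + π) * g t) := by
      simp only [convPrimitive]
      congr 1
      ext t
      push_cast
      ring
    rw [e, intervalIntegral.integral_add, intervalIntegral.integral_sub, ← hconv, ← hconv,
      intervalIntegral.integral_const_mul, ← hm_def]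
    · have h0 : G₀ (-π) = 0 := by simp [hG₀, hF.2.1]
      rw [h0, hG₀]
      field_simp
      ring
    · exact L1.intervalIntegrable_mul hg (by fun_prop) _ _
    · exact L1.intervalIntegrable_mul hg (by fun_prop) _ _
    · exact (L1.intervalIntegrable_mul hg (by fun_prop) _ _).sub
        (L1.intervalIntegrable_mul hg (by fun_prop) _ _)
    · exact (L1.intervalIntegrable hg _ _).const_mul _

end ContinuousPrimitive

theorem theorem5 (𝕜 : Type*) [RCLike 𝕜] :
    (∀ g ∈ ContinuousPrimitive.L1 𝕜, ∀ h ∈ ContinuousPrimitive.Ac 𝕜,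
      ∃! u, ContinuousPrimitive.IsConvolution g h u) ∧
    ContinuousPrimitive.Ac 𝕜 =
      {f | ∃ g ∈ ContinuousPrimitive.L1 𝕜, ∃ h ∈ ContinuousPrimitive.Ac 𝕜,
        ContinuousPrimitive.IsConvolution g h f} := by
  refine ⟨fun g hg h hh => ?_, Set.ext fun f => ⟨?_, ?_⟩⟩
  · obtain ⟨H, hH⟩ := hh
    exact ⟨_, ContinuousPrimitive.isConvolution_of_isPrimitive hg hH
      ⟨ContinuousPrimitive.convPrimitive_mem_Bc hg hH.1, rfl⟩, fun v hv =>
        hv.unique ⟨H, hH⟩ hg (ContinuousPrimitive.isConvolution_of_isPrimitive hg hH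
          ⟨ContinuousPrimitive.convPrimitive_mem_Bc hg hH.1, rfl⟩)⟩
  · rintro ⟨F, hF⟩
    obtain ⟨g, hg, H, hH, rfl⟩ := ContinuousPrimitive.exists_convPrimitive_eq hF.1
    exact ⟨g, hg, _, ⟨H, hH, rfl⟩,
      ContinuousPrimitive.isConvolution_of_isPrimitive hg ⟨hH, rfl⟩ hF⟩
  · rintro ⟨g, -, h, -, hf⟩
    exact hf.1
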